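/- **Setting.** Let $V,H$ be real separable Hilbert spaces with a dense continuous embedding $V\subset H$, and let $a\colon V\times V\to\mathbb R$ be a bounded, symmetric bilinear form that is coercive, $a(v,v)\ge\lambda_-\|v\|_V^2$ for all $v\in V$, with some $\lambda_->0$. Write $\mathbb R_>=(0,\infty)$. Let $$X=H^{1/2}_{00,\{0\}}(\mathbb R_>;H)\cap L^2(\mathbb R_>;V),\qquad Y=H^{1/2}(\mathbb R_>;H)\cap L^2(\mathbb R_>;V),$$ where $H^{1/2}(\mathbb R_>;H)$ and $H^{1/2}_{00,\{0\}}(\mathbb R_>;H)$ consist of the functions in $L^2(\mathbb R_>;H)$ for which the $H$-part of the following (Hilbert) norms is finite: $$\|v\|_Y^2=\|v\|_{L^2(\mathbb R_>;V)}^2+\|v\|_{L^2(\mathbb R_>;H)}^2+\int_0^\infty\!\!\int_0^\infty\frac{\|v(s)-v(t)\|_H^2}{|s-t|^2}\,ds\,dt,$$ $$\|w\|_X^2=\|w\|_Y^2+\int_0^\infty\frac{\|w(s)\|_H^2}{s}\,ds .$$ For smooth compactly supported $\varphi$ put $(D_+^{1/2}\varphi)(t)=\frac{1}{\Gamma(1/2)}\frac{d}{dt}\int_0^t(t-s)^{-1/2}\varphi(s)\,ds$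 and $(D_-^{1/2}\varphi)(t)=-\frac{1}{\Gamma(1/2)}\frac{d}{dt}\int_t^\infty(s-t)^{-1/2}\varphi(s)\,ds$. For $w\in X$ and $v\in Y$ the half derivatives $D_+^{1/2}w,\ D_-^{1/2}v\in L^2(\mathbb R_>;H)$ are understood weakly: $\int_{\mathbb R_>}\varphi\,D_+^{1/2}w\,dt=\int_{\mathbb R_>}(D_-^{1/2}\varphi)\,w\,dt$ for all restrictions $\varphi$ to $\mathbb R_>$ of functions in $C_c^\infty(\mathbb R)$, and $\int_{\mathbb R_>}\varphi\,D_-^{1/2}v\,dt=\int_{\mathbb R_>}(D_+^{1/2}\varphi)\,v\,dt$ for all $\varphi\in C_c^\infty(\mathbb R_>)$. Define $$\mathcal B(w,v)=\int_{\mathbb R_>}\Big\{\big(D_+^{1/2}w,D_-^{1/2}v\big)_H+a(w,v)\Big\}\,dt,\qquad w\in X,\ v\in Y .$$ Let $(X^\ell)_{\ell\ge0}$ and $(Y^\ell)_{\ell\ge0}$ be nested (increasing) families of finite-dimensional subspaces of $X$ and $Y$, with $\bigcup_\ell X^\ell$ dense in $X$, $\bigcup_\ell Y^\ell$ dense in $Y$,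 and $\dim X^\ell=\dim Y^\ell$ for all $\ell$. **Proposition.** Assume that there is $\bar\gamma>0$ such that for all $\ell\ge0$ $$\inf_{0\ne w\in X^\ell}\ \sup_{0\ne v\in Y^\ell}\frac{\mathcal B(w,v)}{\|w\|_X\|v\|_Y}\ \ge\ \bar\gamma$$ (an infimum over the empty set being $+\infty$). Then: 1. For every $F\in Y^*$ and every $\ell\ge 0$ there is a unique $u^\ell\in X^\ell$ with $\mathcal B(u^\ell,v)=F(v)$ for all $v\in Y^\ell$. 2. For every $\ell\ge 0$ the stiffness matrix $\big(\mathcal B(\varphi_j,\psi_i)\big)_{i,j}$ is nonsingular, for every basis $(\varphi_j)$ of $X^\ell$ and every basis $(\psi_i)$ of $Y^\ell$. 3. Let $C$ be a constant with $|\mathcal B(w,v)|\le C\|w\|_X\|v\|_Y$ for all $w\in X$, $v\in Y$. If $F\in Y^*$, if $u\in X$ solves $\mathcal B(u,v)=F(v)$ for all $v\in Y$, and if $u^\ell$ is the Galerkin solution of part 1, then $$\|u-u^\ell\|_X\ \le\ \frac{C}{\bar\gamma}\ \inf_{v\in X^\ell}\|u-v\|_X\qquad\text{for every }\ell\ge 0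 .$$ -/

import Mathlib

open MeasureTheory Set
open scoped ContDiff

noncomputable section

/-- Lebesgue measure on the half line `(0, ∞)`. -/
abbrev halfLine : Measure ℝ := volume.restrict (Ioi (0 : ℝ))

/-! ### Fractional calculus on the half line -/

/-- The left-sided Riemann-Liouville fractional integral of order `α` on `(0, ∞)`. -/
def fracIntegralPlus (α : ℝ) (φ : ℝ → ℝ) (t : ℝ) : ℝ :=
  (Real.Gamma α)⁻¹ * ∫ s in Ioo 0 t, (t - s) ^ (α - 1) * φ s

/-- The right-sided Riemann-Liouville fractional integral of order `α`. -/
def fracIntegralMinus (α : ℝ) (φ : ℝ → ℝ) (t : ℝ) : ℝ :=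
  (Real.Gamma α)⁻¹ * ∫ s in Ioi t, (s - t) ^ (α - 1) * φ s

/-- The fractional derivative `D₊^α φ = D I₊^(1-α) φ` of a smooth function. -/
def fracDerivPlus (α : ℝ) (φ : ℝ → ℝ) (t : ℝ) : ℝ :=
  deriv (fracIntegralPlus (1 - α) φ) t

/-- The fractional derivative `D₋^α φ = - D I₋^(1-α) φ` of a smooth function. -/
def fracDerivMinus (α : ℝ) (φ : ℝ → ℝ) (t : ℝ) : ℝ :=
  -deriv (fracIntegralMinus (1 - α) φ) t

section HalfDerivative

variable {H : Type*} [NormedAddCommGroup H] [InnerProductSpace ℝ H]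

/-- `p ∈ L²((0,∞);H)` is the weak derivative `D₊^{1/2} u` of `u ∈ L²((0,∞);H)`:
`∫ φ p = ∫ (D₋^{1/2} φ) u` for all test functions `φ`. The test functions are the restrictions
to `(0, ∞)` of functions in `C_c^∞(ℝ)`; they need not vanish at `0`, so that this is the derivative
of `u` extended by zero. (The products are always integrable, both factors being in `L²`.) -/
def IsHalfDerivPlus (u p : Lp H 2 halfLine) : Prop :=
  ∀ φ : ℝ → ℝ, ContDiff ℝ ∞ φ → HasCompactSupport φ →
    Integrable (fun t => φ t • p t) halfLine ∧
    Integrable (fun t => fracDerivMinus (1 / 2) φ t • u t) halfLine ∧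
    ∫ t, φ t • p t ∂halfLine = ∫ t, fracDerivMinus (1 / 2) φ t • u t ∂halfLine

/-- `p ∈ L²((0,∞);H)` is the weak derivative `D₋^{1/2} u` of `u ∈ L²((0,∞);H)`:
`∫ φ p = ∫ (D₊^{1/2} φ) u` for all test functions `φ ∈ C_c^∞((0,∞))`.
(The products are always integrable, both factors being in `L²`.) -/
def IsHalfDerivMinus (u p : Lp H 2 halfLine) : Prop :=
  ∀ φ : ℝ → ℝ, ContDiff ℝ ∞ φ → HasCompactSupport φ → tsupport φ ⊆ Ioi 0 →
    Integrable (fun t => φ t • p t) halfLine ∧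
    Integrable (fun t => fracDerivPlus (1 / 2) φ t • u t) halfLine ∧
    ∫ t, φ t • p t ∂halfLine = ∫ t, fracDerivPlus (1 / 2) φ t • u t ∂halfLine

theorem weakIdentity_add {φ ψ : ℝ → ℝ} {u p u' p' : Lp H 2 halfLine}
    (h : Integrable (fun t => φ t • p t) halfLine ∧ Integrable (fun t => ψ t • u t) halfLine ∧
      ∫ t, φ t • p t ∂halfLine = ∫ t, ψ t • u t ∂halfLine)
    (h' : Integrable (fun t => φ t • p' t) halfLine ∧ Integrable (fun t => ψ t • u' t) halfLine ∧
      ∫ t, φ t • p' t ∂halfLine = ∫ t, ψ t • u' t ∂halfLine) :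
    Integrable (fun t => φ t • (p + p') t) halfLine ∧
      Integrable (fun t => ψ t • (u + u') t) halfLine ∧
      ∫ t, φ t • (p + p') t ∂halfLine = ∫ t, ψ t • (u + u') t ∂halfLine := by
  have e1 : (fun t => φ t • (p + p') t) =ᵐ[halfLine] fun t => φ t • p t + φ t • p' t := by
    filter_upwards [Lp.coeFn_add p p'] with t ht
    simp only [ht, Pi.add_apply, smul_add]
  have e2 : (fun t => ψ t • (u + u') t) =ᵐ[halfLine] fun t => ψ t • u t + ψ t • u' t := by
    filter_upwards [Lp.coeFn_add u u'] with t ht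
    simp only [ht, Pi.add_apply, smul_add]
  refine ⟨(h.1.add h'.1).congr e1.symm, (h.2.1.add h'.2.1).congr e2.symm, ?_⟩
  rw [integral_congr_ae e1, integral_congr_ae e2, integral_add h.1 h'.1,
    integral_add h.2.1 h'.2.1, h.2.2, h'.2.2]

theorem weakIdentity_smul {φ ψ : ℝ → ℝ} {u p : Lp H 2 halfLine} (c : ℝ)
    (h : Integrable (fun t => φ t • p t) halfLine ∧ Integrable (fun t => ψ t • u t) halfLine ∧
      ∫ t, φ t • p t ∂halfLine = ∫ t, ψ t • u t ∂halfLine) :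
    Integrable (fun t => φ t • (c • p) t) halfLine ∧
      Integrable (fun t => ψ t • (c • u) t) halfLine ∧
      ∫ t, φ t • (c • p) t ∂halfLine = ∫ t, ψ t • (c • u) t ∂halfLine := by
  have e1 : (fun t => φ t • (c • p) t) =ᵐ[halfLine] fun t => c • (φ t • p t) := by
    filter_upwards [Lp.coeFn_smul c p] with t ht
    simp only [ht, Pi.smul_apply, smul_comm c]
  have e2 : (fun t => ψ t • (c • u) t) =ᵐ[halfLine] fun t => c • (ψ t • u t) := by
    filter_upwards [Lp.coeFn_smul c u] with t ht
    simp only [ht, Pi.smul_apply, smul_comm c]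
  refine ⟨(h.1.smul c).congr e1.symm, (h.2.1.smul c).congr e2.symm, ?_⟩
  rw [integral_congr_ae e1, integral_congr_ae e2, integral_smul, integral_smul, h.2.2]

theorem weakIdentity_zero (φ ψ : ℝ → ℝ) :
    Integrable (fun t => φ t • (0 : Lp H 2 halfLine) t) halfLine ∧
      Integrable (fun t => ψ t • (0 : Lp H 2 halfLine) t) halfLine ∧
      ∫ t, φ t • (0 : Lp H 2 halfLine) t ∂halfLine
        = ∫ t, ψ t • (0 : Lp H 2 halfLine) t ∂halfLine := by
  have e : ∀ χ : ℝ → ℝ, (fun t => χ t • (0 : Lp H 2 halfLine) t) =ᵐ[halfLine] fun _ => (0 : H) := by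
    intro χ
    filter_upwards [Lp.coeFn_zero H 2 halfLine] with t ht
    simp only [ht, Pi.zero_apply, smul_zero]
  refine ⟨(integrable_zero _ _ _).congr (e φ).symm, (integrable_zero _ _ _).congr (e ψ).symm, ?_⟩
  rw [integral_congr_ae (e φ), integral_congr_ae (e ψ)]

variable (H)

/-- The graph of `D₊^{1/2}` in `L² × L²`. -/
def halfDerivPlusGraph : Submodule ℝ (Lp H 2 halfLine × Lp H 2 halfLine) where
  carrier := {x | IsHalfDerivPlus x.1 x.2}
  add_mem' := fun h h' φ h1 h2 => weakIdentity_add (h φ h1 h2) (h' φ h1 h2)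
  zero_mem' := fun φ _ _ => weakIdentity_zero φ _
  smul_mem' := fun c _ h φ h1 h2 => weakIdentity_smul c (h φ h1 h2)

/-- The graph of `D₋^{1/2}` in `L² × L²`. -/
def halfDerivMinusGraph : Submodule ℝ (Lp H 2 halfLine × Lp H 2 halfLine) where
  carrier := {x | IsHalfDerivMinus x.1 x.2}
  add_mem' := fun h h' φ h1 h2 h3 => weakIdentity_add (h φ h1 h2 h3) (h' φ h1 h2 h3)
  zero_mem' := fun φ _ _ _ => weakIdentity_zero φ _
  smul_mem' := fun c _ h φ h1 h2 h3 => weakIdentity_smul c (h φ h1 h2 h3)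

/-- The operator `D₊^{1/2}` on `L²((0,∞);H)`. On its natural domain, which is
`H^{1/2}_{00,{0}}((0,∞);H)`, it is the weak derivative (see `halfDerivPlus_eq`); elsewhere it takes
junk values, chosen linearly. -/
def halfDerivPlus : Lp H 2 halfLine →ₗ[ℝ] Lp H 2 halfLine :=
  (LinearMap.exists_extend (halfDerivPlusGraph H).toLinearPMap.toFun).choose

/-- The operator `D₋^{1/2}` on `L²((0,∞);H)`. On its natural domain, which is
`H^{1/2}((0,∞);H)`, it is the weak derivative (see `halfDerivMinus_eq`); elsewhere it takes
junk values, chosen linearly. -/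
def halfDerivMinus : Lp H 2 halfLine →ₗ[ℝ] Lp H 2 halfLine :=
  (LinearMap.exists_extend (halfDerivMinusGraph H).toLinearPMap.toFun).choose

variable {H}

theorem eq_zero_of_isHalfDerivMinus_zero [CompleteSpace H] {p : Lp H 2 halfLine}
    (h : IsHalfDerivMinus 0 p) : p = 0 := by
  rw [Lp.eq_zero_iff_ae_eq_zero]
  have hloc : LocallyIntegrable p halfLine :=
    (Lp.memLp p).locallyIntegrable (by norm_num)
  have := isOpen_Ioi.ae_eq_zero_of_integral_contDiff_smul_eq_zero (μ := halfLine)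
    (U := Ioi (0 : ℝ)) (f := p) (hloc.locallyIntegrableOn _) (fun φ h1 h2 h3 => by
      rw [(h φ h1 h2 h3).2.2]
      rw [integral_congr_ae (g := fun _ => (0 : H)), integral_zero]
      filter_upwards [Lp.coeFn_zero H 2 halfLine] with t ht
      simp only [ht, Pi.zero_apply, smul_zero])
  filter_upwards [this, ae_restrict_mem measurableSet_Ioi] with t h1 h2 using h1 h2

theorem eq_zero_of_isHalfDerivPlus_zero [CompleteSpace H] {p : Lp H 2 halfLine}
    (h : IsHalfDerivPlus 0 p) : p = 0 := by
  refine eq_zero_of_isHalfDerivMinus_zero fun φ h1 h2 _ => ?_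
  have hz := weakIdentity_zero (H := H) φ (fracDerivPlus (1 / 2) φ)
  have hz' := weakIdentity_zero (H := H) φ (fracDerivMinus (1 / 2) φ)
  refine ⟨(h φ h1 h2).1, hz.2.1, ?_⟩
  rw [(h φ h1 h2).2.2, ← hz.2.2, hz'.2.2]

/-- `D₊^{1/2} u` is the weak half derivative of `u` whenever there is one. -/
theorem halfDerivPlus_eq [CompleteSpace H] {u p : Lp H 2 halfLine} (h : IsHalfDerivPlus u p) :
    halfDerivPlus H u = p := by
  have hg : ∀ x ∈ halfDerivPlusGraph H, x.fst = 0 → x.snd = 0 := by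
    rintro ⟨x, y⟩ hx rfl
    exact eq_zero_of_isHalfDerivPlus_zero hx
  have hmem : (u, p) ∈ (halfDerivPlusGraph H).toLinearPMap.graph := by
    rw [Submodule.toLinearPMap_graph_eq _ hg]; exact h
  obtain ⟨y, hy1, hy2⟩ := (LinearPMap.mem_graph_iff _).1 hmem
  have := LinearMap.congr_fun
    (LinearMap.exists_extend (halfDerivPlusGraph H).toLinearPMap.toFun).choose_spec y
  simp only at hy1 hy2
  rw [← hy1, ← hy2]
  exact this

/-- `D₋^{1/2} u` is the weak half derivative of `u` whenever there is one. -/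
theorem halfDerivMinus_eq [CompleteSpace H] {u p : Lp H 2 halfLine} (h : IsHalfDerivMinus u p) :
    halfDerivMinus H u = p := by
  have hg : ∀ x ∈ halfDerivMinusGraph H, x.fst = 0 → x.snd = 0 := by
    rintro ⟨x, y⟩ hx rfl
    exact eq_zero_of_isHalfDerivMinus_zero hx
  have hmem : (u, p) ∈ (halfDerivMinusGraph H).toLinearPMap.graph := by
    rw [Submodule.toLinearPMap_graph_eq _ hg]; exact h
  obtain ⟨y, hy1, hy2⟩ := (LinearPMap.mem_graph_iff _).1 hmem
  have := LinearMap.congr_fun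
    (LinearMap.exists_extend (halfDerivMinusGraph H).toLinearPMap.toFun).choose_spec y
  simp only at hy1 hy2
  rw [← hy1, ← hy2]
  exact this

end HalfDerivative

/-! ### The spaces `X` and `Y` -/

section Spaces

variable {H : Type*} [NormedAddCommGroup H] [InnerProductSpace ℝ H]

/-- The difference quotient whose `L²((0,∞)²)` norm is the seminorm of `H^{1/2}((0,∞);H)`. -/
def diffQuot (u : ℝ → H) (z : ℝ × ℝ) : H := (z.1 - z.2)⁻¹ • (u z.1 - u z.2)

/-- The function `s ↦ s^{-1/2} u(s)`. -/
def hardyWeight (u : ℝ → H) (s : ℝ) : H := (√s)⁻¹ • u s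

theorem diffQuot_congr {u v : ℝ → H} (h : u =ᵐ[halfLine] v) :
    diffQuot u =ᵐ[halfLine.prod halfLine] diffQuot v := by
  filter_upwards [Measure.quasiMeasurePreserving_fst.ae h,
    Measure.quasiMeasurePreserving_snd.ae h] with z h1 h2
  simp only [diffQuot, h1, h2]

theorem diffQuot_add (u v : ℝ → H) : diffQuot (u + v) = diffQuot u + diffQuot v := by
  funext z
  simp only [diffQuot, Pi.add_apply, ← smul_add]
  congr 1
  abel

theorem diffQuot_smul (c : ℝ) (u : ℝ → H) : diffQuot (c • u) = c • diffQuot u := by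
  funext z
  simp only [diffQuot, Pi.smul_apply, ← smul_sub, smul_comm c]

theorem hardyWeight_congr {u v : ℝ → H} (h : u =ᵐ[halfLine] v) :
    hardyWeight u =ᵐ[halfLine] hardyWeight v := by
  filter_upwards [h] with s hs
  simp only [hardyWeight, hs]

theorem hardyWeight_add (u v : ℝ → H) :
    hardyWeight (u + v) = hardyWeight u + hardyWeight v := by
  funext s
  simp [hardyWeight]

theorem hardyWeight_smul (c : ℝ) (u : ℝ → H) : hardyWeight (c • u) = c • hardyWeight u := by
  funext s
  simp [hardyWeight, smul_comm c]

variable (H)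

/-- `H^{1/2}((0,∞);H)`, as a subspace of `L²((0,∞);H)`. -/
def halfSobolev : Submodule ℝ (Lp H 2 halfLine) where
  carrier := {u | MemLp (diffQuot u) 2 (halfLine.prod halfLine)}
  add_mem' := fun {u v} hu hv => (memLp_congr_ae (diffQuot_congr (Lp.coeFn_add u v))).2
    (by rw [diffQuot_add]; exact MemLp.add hu hv)
  zero_mem' := by
    refine (memLp_congr_ae (diffQuot_congr (Lp.coeFn_zero H 2 halfLine))).2 ?_
    have : diffQuot (0 : ℝ → H) = 0 := by funext z; simp [diffQuot]
    rw [this]; exact MemLp.zero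
  smul_mem' := fun c {u} hu => (memLp_congr_ae (diffQuot_congr (Lp.coeFn_smul c u))).2
    (by rw [diffQuot_smul]; exact MemLp.const_smul hu c)

/-- `H^{1/2}_{00,{0}}((0,∞);H)`, as a subspace of `L²((0,∞);H)`. -/
def halfSobolevZero : Submodule ℝ (Lp H 2 halfLine) where
  carrier := {u | u ∈ halfSobolev H ∧ MemLp (hardyWeight u) 2 halfLine}
  add_mem' := fun {u v} hu hv => ⟨add_mem hu.1 hv.1,
    (memLp_congr_ae (hardyWeight_congr (Lp.coeFn_add u v))).2
      (by rw [hardyWeight_add]; exact MemLp.add hu.2 hv.2)⟩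
  zero_mem' := by
    refine ⟨zero_mem _, (memLp_congr_ae (hardyWeight_congr (Lp.coeFn_zero H 2 halfLine))).2 ?_⟩
    have : hardyWeight (0 : ℝ → H) = 0 := by funext z; simp [hardyWeight]
    rw [this]; exact MemLp.zero
  smul_mem' := fun c {u} hu => ⟨Submodule.smul_mem _ c hu.1,
    (memLp_congr_ae (hardyWeight_congr (Lp.coeFn_smul c u))).2
      (by rw [hardyWeight_smul]; exact MemLp.const_smul hu.2 c)⟩

variable {H}

theorem memLp_diffQuot (u : halfSobolev H) :
    MemLp (diffQuot (u : Lp H 2 halfLine)) 2 (halfLine.prod halfLine) := u.2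

theorem memLp_hardyWeight (u : halfSobolevZero H) :
    MemLp (hardyWeight (u : Lp H 2 halfLine)) 2 halfLine := u.2.2

/-- The difference quotient, as an operator into `L²((0,∞)²;H)`. -/
def diffQuotL : halfSobolev H →ₗ[ℝ] Lp H 2 (halfLine.prod halfLine) where
  toFun u := (memLp_diffQuot u).toLp _
  map_add' u v := by
    rw [← MemLp.toLp_add, MemLp.toLp_eq_toLp_iff, ← diffQuot_add]
    exact diffQuot_congr (Lp.coeFn_add u.1 v.1)
  map_smul' c u := by
    rw [RingHom.id_apply, ← MemLp.toLp_const_smul, MemLp.toLp_eq_toLp_iff, ← diffQuot_smul]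
    exact diffQuot_congr (Lp.coeFn_smul c u.1)

/-- `u ↦ s^{-1/2} u`, as an operator into `L²((0,∞);H)`. -/
def hardyWeightL : halfSobolevZero H →ₗ[ℝ] Lp H 2 halfLine where
  toFun u := (memLp_hardyWeight u).toLp _
  map_add' u v := by
    rw [← MemLp.toLp_add, MemLp.toLp_eq_toLp_iff, ← hardyWeight_add]
    exact hardyWeight_congr (Lp.coeFn_add u.1 v.1)
  map_smul' c u := by
    rw [RingHom.id_apply, ← MemLp.toLp_const_smul, MemLp.toLp_eq_toLp_iff, ← hardyWeight_smul]
    exact hardyWeight_congr (Lp.coeFn_smul c u.1)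

variable {V : Type*} [NormedAddCommGroup V] [InnerProductSpace ℝ V]

/-- The embedding `L²((0,∞);V) → L²((0,∞);H)` induced by an embedding `ι : V → H`. -/
abbrev embL (ι : V →L[ℝ] H) : Lp V 2 halfLine →ₗ[ℝ] Lp H 2 halfLine :=
  (ContinuousLinearMap.compLpL 2 halfLine ι).toLinearMap

/-- The trial space `X = H^{1/2}_{00,{0}}((0,∞);H) ∩ L²((0,∞);V)`. -/
def TrialSpace (ι : V →L[ℝ] H) : Type _ := (halfSobolevZero H).comap (embL ι)

/-- The test space `Y = H^{1/2}((0,∞);H) ∩ L²((0,∞);V)`. -/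
def TestSpace (ι : V →L[ℝ] H) : Type _ := (halfSobolev H).comap (embL ι)

instance (ι : V →L[ℝ] H) : AddCommGroup (TrialSpace ι) :=
  inferInstanceAs (AddCommGroup ((halfSobolevZero H).comap (embL ι)))

instance (ι : V →L[ℝ] H) : Module ℝ (TrialSpace ι) :=
  inferInstanceAs (Module ℝ ((halfSobolevZero H).comap (embL ι)))

instance (ι : V →L[ℝ] H) : AddCommGroup (TestSpace ι) :=
  inferInstanceAs (AddCommGroup ((halfSobolev H).comap (embL ι)))

instance (ι : V →L[ℝ] H) : Module ℝ (TestSpace ι) :=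
  inferInstanceAs (Module ℝ ((halfSobolev H).comap (embL ι)))

variable {ι : V →L[ℝ] H}

/-- An element of `X` as an element of `L²((0,∞);V)`. -/
def TrialSpace.toL2V : TrialSpace ι →ₗ[ℝ] Lp V 2 halfLine :=
  ((halfSobolevZero H).comap (embL ι)).subtype

/-- An element of `X` as an element of `H^{1/2}_{00,{0}}((0,∞);H)`. -/
def TrialSpace.toSobolev : TrialSpace ι →ₗ[ℝ] halfSobolevZero H :=
  (embL ι).restrict (p := (halfSobolevZero H).comap (embL ι)) (fun _ h => h)

/-- An element of `Y` as an element of `L²((0,∞);V)`. -/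
def TestSpace.toL2V : TestSpace ι →ₗ[ℝ] Lp V 2 halfLine :=
  ((halfSobolev H).comap (embL ι)).subtype

/-- An element of `Y` as an element of `H^{1/2}((0,∞);H)`. -/
def TestSpace.toSobolev : TestSpace ι →ₗ[ℝ] halfSobolev H :=
  (embL ι).restrict (p := (halfSobolev H).comap (embL ι)) (fun _ h => h)

/-- `H^{1/2}_{00,{0}}((0,∞);H) ⊆ H^{1/2}((0,∞);H)`. -/
def halfSobolevIncl : halfSobolevZero H →ₗ[ℝ] halfSobolev H :=
  Submodule.inclusion (fun _ h => h.1)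

/-- An element of `X` as an element of `L²((0,∞);H)`. -/
def TrialSpace.toL2H : TrialSpace ι →ₗ[ℝ] Lp H 2 halfLine :=
  (halfSobolevZero H).subtype ∘ₗ TrialSpace.toSobolev

/-- The difference quotient of an element of `X`, in `L²((0,∞)²;H)`. -/
def TrialSpace.quot : TrialSpace ι →ₗ[ℝ] Lp H 2 (halfLine.prod halfLine) :=
  diffQuotL ∘ₗ halfSobolevIncl ∘ₗ TrialSpace.toSobolev

/-- The function `s ↦ s^{-1/2} w(s)` for `w` in `X`, in `L²((0,∞);H)`. -/
def TrialSpace.weight : TrialSpace ι →ₗ[ℝ] Lp H 2 halfLine :=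
  hardyWeightL ∘ₗ TrialSpace.toSobolev

/-- An element of `Y` as an element of `L²((0,∞);H)`. -/
def TestSpace.toL2H : TestSpace ι →ₗ[ℝ] Lp H 2 halfLine :=
  (halfSobolev H).subtype ∘ₗ TestSpace.toSobolev

/-- The difference quotient of an element of `Y`, in `L²((0,∞)²;H)`. -/
def TestSpace.quot : TestSpace ι →ₗ[ℝ] Lp H 2 (halfLine.prod halfLine) :=
  diffQuotL ∘ₗ TestSpace.toSobolev

/-- The inner product of `X`, whose norm is
`‖w‖_X² = ‖w‖²_{L²(V)} + ‖w‖²_{L²(H)} + ∬ ‖w(s)-w(t)‖_H² / |s-t|² ds dt + ∫ ‖w(s)‖_H² / s ds`. -/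
abbrev trialCore (ι : V →L[ℝ] H) : InnerProductSpace.Core ℝ (TrialSpace ι) where
  inner w z := inner ℝ w.toL2V z.toL2V
    + inner ℝ w.toL2H z.toL2H
    + inner ℝ w.quot z.quot
    + inner ℝ w.weight z.weight
  conj_inner_symm w z := by
    rw [conj_trivial, real_inner_comm w.toL2V z.toL2V, real_inner_comm w.toL2H z.toL2H,
      real_inner_comm w.quot z.quot, real_inner_comm w.weight z.weight]
  re_inner_nonneg w := (add_nonneg (add_nonneg (add_nonneg (real_inner_self_nonneg (x := w.toL2V))
    (real_inner_self_nonneg (x := w.toL2H)))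
    (real_inner_self_nonneg (x := w.quot)))
    (real_inner_self_nonneg (x := w.weight)))
  add_left w z y := by
    rw [map_add TrialSpace.toL2V, map_add TrialSpace.toL2H, map_add TrialSpace.quot,
      map_add TrialSpace.weight, inner_add_left, inner_add_left, inner_add_left, inner_add_left]
    ring
  smul_left w z c := by
    rw [map_smul TrialSpace.toL2V, map_smul TrialSpace.toL2H, map_smul TrialSpace.quot,
      map_smul TrialSpace.weight, real_inner_smul_left, real_inner_smul_left,
      real_inner_smul_left, real_inner_smul_left, conj_trivial]
    ring
  definite w h := by
    have h_toL2V := real_inner_self_nonneg (x := w.toL2V)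
    have h_toL2H := real_inner_self_nonneg (x := w.toL2H)
    have h_quot := real_inner_self_nonneg (x := w.quot)
    have h_weight := real_inner_self_nonneg (x := w.weight)
    have h0 : inner ℝ w.toL2V w.toL2V = 0 := by linarith
    exact Subtype.ext (inner_self_eq_zero.1 h0)

/-- The inner product of `Y`, whose norm is
`‖v‖_Y² = ‖v‖²_{L²(V)} + ‖v‖²_{L²(H)} + ∬ ‖v(s)-v(t)‖_H² / |s-t|² ds dt`. -/
abbrev testCore (ι : V →L[ℝ] H) : InnerProductSpace.Core ℝ (TestSpace ι) where
  inner w z := inner ℝ w.toL2V z.toL2V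
    + inner ℝ w.toL2H z.toL2H
    + inner ℝ w.quot z.quot
  conj_inner_symm w z := by
    rw [conj_trivial, real_inner_comm w.toL2V z.toL2V, real_inner_comm w.toL2H z.toL2H,
      real_inner_comm w.quot z.quot]
  re_inner_nonneg w := (add_nonneg (add_nonneg (real_inner_self_nonneg (x := w.toL2V))
    (real_inner_self_nonneg (x := w.toL2H)))
    (real_inner_self_nonneg (x := w.quot)))
  add_left w z y := by
    rw [map_add TestSpace.toL2V, map_add TestSpace.toL2H, map_add TestSpace.quot, inner_add_left,
      inner_add_left, inner_add_left]
    ring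
  smul_left w z c := by
    rw [map_smul TestSpace.toL2V, map_smul TestSpace.toL2H, map_smul TestSpace.quot,
      real_inner_smul_left, real_inner_smul_left, real_inner_smul_left, conj_trivial]
    ring
  definite w h := by
    have h_toL2V := real_inner_self_nonneg (x := w.toL2V)
    have h_toL2H := real_inner_self_nonneg (x := w.toL2H)
    have h_quot := real_inner_self_nonneg (x := w.quot)
    have h0 : inner ℝ w.toL2V w.toL2V = 0 := by linarith
    exact Subtype.ext (inner_self_eq_zero.1 h0)

instance (ι : V →L[ℝ] H) : NormedAddCommGroup (TrialSpace ι) :=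
  (trialCore ι).toNormedAddCommGroup

instance (ι : V →L[ℝ] H) : InnerProductSpace ℝ (TrialSpace ι) :=
  InnerProductSpace.ofCore (trialCore ι).toCore

instance (ι : V →L[ℝ] H) : NormedAddCommGroup (TestSpace ι) :=
  (testCore ι).toNormedAddCommGroup

instance (ι : V →L[ℝ] H) : InnerProductSpace ℝ (TestSpace ι) :=
  InnerProductSpace.ofCore (testCore ι).toCore

/-! ### The bilinear form, its Petrov-Galerkin discretization and the discrete inf-sup constant -/

/-- The space-time bilinear form
`B(w, v) = ∫₀^∞ { (D₊^{1/2} w, D₋^{1/2} v)_H + a(w, v) } dt` on `X × Y`. -/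
def spaceTimeForm (ι : V →L[ℝ] H) (a : V →L[ℝ] V →L[ℝ] ℝ)
    (w : TrialSpace ι) (v : TestSpace ι) : ℝ :=
  ∫ t, (inner ℝ (halfDerivPlus H w.toL2H t) (halfDerivMinus H v.toL2H t)
    + a (w.toL2V t) (v.toL2V t)) ∂halfLine

/-- `u ∈ X` solves the space-time weak formulation with right-hand side `F ∈ Y*`. -/
def IsWeakSolution (ι : V →L[ℝ] H) (a : V →L[ℝ] V →L[ℝ] ℝ) (F : TestSpace ι →L[ℝ] ℝ)
    (u : TrialSpace ι) : Prop :=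
  ∀ v : TestSpace ι, spaceTimeForm ι a u v = F v

/-- `u ∈ Xl` solves the Petrov-Galerkin problem with trial space `Xl` and test space `Yl`. -/
def IsGalerkinSolution (ι : V →L[ℝ] H) (a : V →L[ℝ] V →L[ℝ] ℝ)
    (Xl : Submodule ℝ (TrialSpace ι)) (Yl : Submodule ℝ (TestSpace ι))
    (F : TestSpace ι →L[ℝ] ℝ) (u : Xl) : Prop :=
  ∀ v : Yl, spaceTimeForm ι a u v = F v

/-- `inf_{0 ≠ w ∈ Xl} sup_{0 ≠ v ∈ Yl} B(w, v) / (‖w‖_X ‖v‖_Y)`, in the extended reals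
(so that infima over the empty set are `+∞`). -/
def discreteInfSup (ι : V →L[ℝ] H) (a : V →L[ℝ] V →L[ℝ] ℝ)
    (Xl : Submodule ℝ (TrialSpace ι)) (Yl : Submodule ℝ (TestSpace ι)) : EReal :=
  ⨅ w : {w : Xl // w ≠ 0}, ⨆ v : {v : Yl // v ≠ 0},
    ((spaceTimeForm ι a w.1 v.1 / (‖w.1‖ * ‖v.1‖) : ℝ) : EReal)

/-- The stiffness matrix of the Petrov-Galerkin problem with respect to bases of `Xl` and `Yl`. -/
def stiffnessMatrix {ι : V →L[ℝ] H} (a : V →L[ℝ] V →L[ℝ] ℝ)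
    {Xl : Submodule ℝ (TrialSpace ι)} {Yl : Submodule ℝ (TestSpace ι)} {n : ℕ}
    (bX : Module.Basis (Fin n) ℝ Xl) (bY : Module.Basis (Fin n) ℝ Yl) :
    Matrix (Fin n) (Fin n) ℝ :=
  Matrix.of fun i j => spaceTimeForm ι a (bX j) (bY i)

end Spaces

end

/-! The inf-sup bound says that a nonzero `w` in `X^ℓ` cannot be annihilated by all of `Y^ℓ`, so `w
↦ B(w, ·)` is injective from `X^ℓ` to the dual of `Y^ℓ`. Equal finite dimensions make it bijective,
which is part 1 (`bijective_of_infSup`). Injectivity read in bases is part 2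
(`LinearMap.det_of_ne_zero_of_injective`).

For part 3, let `N` be the space of `y` in `X` with `B(y, ·) = 0` on `Y^ℓ`. Galerkin orthogonality
puts `u - u^ℓ` in `N`, and `u - v = (u^ℓ - v) + (u - u^ℓ)` splits into a part in `X^ℓ` and a part in
`N`. Inf-sup and continuity bound the `X^ℓ` part by `(C/γ) ‖u - v‖`
(`mul_norm_le_of_residual_eq_zero`). The triangle inequality would then give only `1 + C/γ` for the
other part. The constant `C/γ` comes from the Hilbert space fact that an oblique projection and its
complement obey the same bound (`norm_le_of_complementary_bound`), provided the bound is at least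
`1`. -/

/-! ### Abstract inf-sup theory and complementary projections. -/

section PetrovGalerkin

variable {E F : Type*} [NormedAddCommGroup E] [NormedAddCommGroup F]

/-- In a real inner product space, if the component `p` of every `p + y` (`p ∈ P`, `y ∈ N`) is
bounded by `K ‖p + y‖` with `1 ≤ K`, then so is the component `y`. -/
theorem norm_le_of_complementary_bound [InnerProductSpace ℝ E] {P N : Submodule ℝ E} {K : ℝ}
    (hK : 1 ≤ K) (h : ∀ p ∈ P, ∀ y ∈ N, ‖p‖ ≤ K * ‖p + y‖) {p y : E} (hp : p ∈ P) (hy : y ∈ N) :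
    ‖y‖ ≤ K * ‖p + y‖ := by
  -- For `p = 0` the hypothesis `h` says nothing about `y`; this is where `1 ≤ K` is needed.
  rcases eq_or_ne p 0 with rfl | hp0
  · rw [zero_add]
    exact le_mul_of_one_le_left (norm_nonneg y) hK
  rcases eq_or_ne y 0 with rfl | hy0
  · rw [norm_zero]
    exact mul_nonneg (zero_le_one.trans hK) (norm_nonneg _)
  have hp' : ‖p‖ ≠ 0 := norm_ne_zero_iff.2 hp0
  have hy' : ‖y‖ ≠ 0 := norm_ne_zero_iff.2 hy0
  -- Rescale so that the two components exchange their lengths. The factors are reciprocal, so the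
  -- inner product is unchanged and the sum keeps its norm, while the `P` component now has length
  -- `‖y‖`.
  have key := h ((‖y‖ / ‖p‖) • p) (P.smul_mem _ hp) ((‖p‖ / ‖y‖) • y) (N.smul_mem _ hy)
  have n1 : ‖(‖y‖ / ‖p‖) • p‖ = ‖y‖ := by
    rw [norm_smul, norm_div, norm_norm, norm_norm, div_mul_cancel₀ _ hp']
  have n2 : ‖(‖p‖ / ‖y‖) • y‖ = ‖p‖ := by
    rw [norm_smul, norm_div, norm_norm, norm_norm, div_mul_cancel₀ _ hy']
  have n3 : ‖(‖y‖ / ‖p‖) • p + (‖p‖ / ‖y‖) • y‖ = ‖p + y‖ := by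
    rw [← sq_eq_sq₀ (norm_nonneg _) (norm_nonneg _), norm_add_sq_real, norm_add_sq_real, n1, n2,
      real_inner_smul_left, real_inner_smul_right]
    field_simp
    ring
  rwa [n1, n3] at key

variable [NormedSpace ℝ E] [NormedSpace ℝ F]

/-- A lower bound for the supremum of the normalized values `b w v` bounds the norm of `w` by
every bound for the functional `b w`. -/
theorem mul_norm_le_of_le_iSup {b : E →ₗ[ℝ] F →ₗ[ℝ] ℝ} {γ : ℝ} {w : E} (hw : w ≠ 0)
    (h : (γ : EReal) ≤ ⨆ v : {v : F // v ≠ 0}, ((b w v.1 / (‖w‖ * ‖v.1‖) : ℝ) : EReal))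
    {M : ℝ} (hM : ∀ v, b w v ≤ M * ‖v‖) : γ * ‖w‖ ≤ M := by
  have hw' : 0 < ‖w‖ := norm_pos_iff.2 hw
  rw [← le_div_iff₀ hw', ← EReal.coe_le_coe_iff]
  -- In `EReal` the supremum needs no boundedness or nonemptiness: over a trivial `F` it is `⊥`, and
  -- `h` is then contradictory.
  refine h.trans (iSup_le fun v => ?_)
  have hv : 0 < ‖v.1‖ := norm_pos_iff.2 v.2
  rw [EReal.coe_le_coe_iff, div_le_div_iff₀ (mul_pos hw' hv) hw']
  nlinarith [mul_le_mul_of_nonneg_right (hM v.1) hw'.le]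

/-- For `w` in the kernel the bound `M = 0` is admissible, which forces `γ * ‖w‖ ≤ 0`. -/
theorem injective_of_infSup {b : E →ₗ[ℝ] F →ₗ[ℝ] ℝ} {γ : ℝ} (hγ : 0 < γ)
    (h : ∀ w : E, w ≠ 0 →
      (γ : EReal) ≤ ⨆ v : {v : F // v ≠ 0}, ((b w v.1 / (‖w‖ * ‖v.1‖) : ℝ) : EReal)) : Function.Injective b := by
  refine (injective_iff_map_eq_zero b).2 fun w hw => by_contra fun hw0 => ?_
  have := mul_norm_le_of_le_iSup (M := 0) hw0 (h w hw0) (fun v => by simp [hw])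
  exact this.not_gt (mul_pos hγ (norm_pos_iff.2 hw0))

theorem bijective_of_infSup [FiniteDimensional ℝ E] [FiniteDimensional ℝ F]
    (hd : Module.finrank ℝ E = Module.finrank ℝ F) {b : E →ₗ[ℝ] F →ₗ[ℝ] ℝ} {γ : ℝ} (hγ : 0 < γ)
    (h : ∀ w : E, w ≠ 0 →
      (γ : EReal) ≤ ⨆ v : {v : F // v ≠ 0}, ((b w v.1 / (‖w‖ * ‖v.1‖) : ℝ) : EReal)) : Function.Bijective b := by
  have hi := injective_of_infSup hγ h
  have hd' : Module.finrank ℝ E = Module.finrank ℝ (Module.Dual ℝ F) :=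
    hd.trans Subspace.dual_finrank_eq.symm
  exact ⟨hi, (LinearMap.injective_iff_surjective_of_finrank_eq_finrank hd').1 hi⟩

end PetrovGalerkin

/-- Columns are indexed by the basis of `E`, so a null vector of the matrix lists the coordinates of
an element on which `b` vanishes against every `bF i`. -/
theorem LinearMap.det_of_ne_zero_of_injective {E F : Type*} [AddCommGroup E] [Module ℝ E]
    [AddCommGroup F] [Module ℝ F] {n : ℕ} {b : E →ₗ[ℝ] F →ₗ[ℝ] ℝ} (hb : Function.Injective b)
    (bE : Module.Basis (Fin n) ℝ E) (bF : Module.Basis (Fin n) ℝ F) :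
    (Matrix.of fun i j => b (bE j) (bF i)).det ≠ 0 := by
  intro hdet
  obtain ⟨c, hc, hc0⟩ := Matrix.exists_mulVec_eq_zero_iff.2 hdet
  have hz : b (∑ j, c j • bE j) = 0 := by
    refine bF.ext fun i => ?_
    have := congrFun hc0 i
    simp only [Matrix.mulVec, dotProduct, Matrix.of_apply, Pi.zero_apply] at this
    simpa [mul_comm] using this
  exact hc (funext fun j => Fintype.linearIndependent_iff.1 bE.linearIndependent c
    ((map_eq_zero_iff b hb).1 hz) j)

/-! ### The space-time form as a bilinear map, and its Galerkin error. -/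

section SpaceTime

variable {V H : Type*} [NormedAddCommGroup V] [InnerProductSpace ℝ V]
  [NormedAddCommGroup H] [InnerProductSpace ℝ H]

theorem integrable_bilin_of_L2 {α : Type*} [MeasurableSpace α] {μ : Measure α}
    (a : V →L[ℝ] V →L[ℝ] ℝ) (f g : Lp V 2 μ) : Integrable (fun t => a (f t) (g t)) μ := by
  refine (((Lp.memLp f).norm.integrable_mul (Lp.memLp g).norm).const_mul ‖a‖).mono'
    (a.aestronglyMeasurable_comp₂ (Lp.aestronglyMeasurable f) (Lp.aestronglyMeasurable g))
    (.of_forall fun t => ?_)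
  simpa [mul_assoc] using a.le_opNorm₂ (f t) (g t)

/-- The bilinear form `(f, g) ↦ ∫ a(f, g)` on `L²`. -/
noncomputable def integralForm {α : Type*} [MeasurableSpace α] (μ : Measure α) (a : V →L[ℝ] V →L[ℝ] ℝ) :
    Lp V 2 μ →ₗ[ℝ] Lp V 2 μ →ₗ[ℝ] ℝ :=
  LinearMap.mk₂ ℝ (fun f g => ∫ t, a (f t) (g t) ∂μ)
    (fun f f' g => by
      rw [← integral_add (integrable_bilin_of_L2 a f g) (integrable_bilin_of_L2 a f' g)]
      refine integral_congr_ae ?_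
      filter_upwards [Lp.coeFn_add f f'] with t ht
      rw [ht]
      simp)
    (fun c f g => by
      rw [smul_eq_mul, ← integral_const_mul]
      refine integral_congr_ae ?_
      filter_upwards [Lp.coeFn_smul c f] with t ht
      rw [ht]
      simp)
    (fun f g g' => by
      rw [← integral_add (integrable_bilin_of_L2 a f g) (integrable_bilin_of_L2 a f g')]
      refine integral_congr_ae ?_
      filter_upwards [Lp.coeFn_add g g'] with t ht
      rw [ht]
      simp)
    (fun c f g => by
      rw [smul_eq_mul, ← integral_const_mul]
      refine integral_congr_ae ?_
      filter_upwards [Lp.coeFn_smul c g] with t ht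
      rw [ht]
      simp)

/-- The space-time form as a bilinear map. -/
noncomputable def spaceTimeBilin (ι : V →L[ℝ] H) (a : V →L[ℝ] V →L[ℝ] ℝ) :
    TrialSpace ι →ₗ[ℝ] TestSpace ι →ₗ[ℝ] ℝ :=
  (innerₗ (Lp H 2 halfLine)).compl₁₂ (halfDerivPlus H ∘ₗ TrialSpace.toL2H)
      (halfDerivMinus H ∘ₗ TestSpace.toL2H)
    + (integralForm halfLine a).compl₁₂ TrialSpace.toL2V TestSpace.toL2V

/-- Both summands are integrable as pairings of `L²` functions, so the integral splits; the first
piece is by definition the inner product of `L²((0,∞);H)`. -/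
theorem spaceTimeBilin_apply (ι : V →L[ℝ] H) (a : V →L[ℝ] V →L[ℝ] ℝ) (w : TrialSpace ι)
    (v : TestSpace ι) : spaceTimeBilin ι a w v = spaceTimeForm ι a w v := by
  rw [spaceTimeForm, integral_add (L2.integrable_inner _ _) (integrable_bilin_of_L2 a _ _)]
  rfl

/-- The restriction of the space-time form to a pair of trial and test spaces. -/
noncomputable def galerkinForm {ι : V →L[ℝ] H} (a : V →L[ℝ] V →L[ℝ] ℝ) (Xl : Submodule ℝ (TrialSpace ι))
    (Yl : Submodule ℝ (TestSpace ι)) : Xl →ₗ[ℝ] Yl →ₗ[ℝ] ℝ :=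
  (spaceTimeBilin ι a).compl₁₂ Xl.subtype Yl.subtype

theorem galerkinForm_apply {ι : V →L[ℝ] H} (a : V →L[ℝ] V →L[ℝ] ℝ)
    (Xl : Submodule ℝ (TrialSpace ι)) (Yl : Submodule ℝ (TestSpace ι)) (w : Xl) (v : Yl) :
    galerkinForm a Xl Yl w v = spaceTimeForm ι a w v :=
  spaceTimeBilin_apply ι a w v

theorem le_iSup_galerkinForm {ι : V →L[ℝ] H} {a : V →L[ℝ] V →L[ℝ] ℝ}
    {Xl : Submodule ℝ (TrialSpace ι)} {Yl : Submodule ℝ (TestSpace ι)} {γ : ℝ}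
    (h : (γ : EReal) ≤ discreteInfSup ι a Xl Yl) :
    ∀ w : Xl, w ≠ 0 → (γ : EReal) ≤ ⨆ v : {v : Yl // v ≠ 0},
      ((galerkinForm a Xl Yl w v.1 / (‖w‖ * ‖v.1‖) : ℝ) : EReal) := by
  intro w hw
  simp only [galerkinForm_apply]
  exact le_iInf_iff.1 h ⟨w, hw⟩

/-- Stability of the oblique projection onto `Xl` along the functions whose residual vanishes on
`Yl`. -/
theorem mul_norm_le_of_residual_eq_zero {ι : V →L[ℝ] H} {a : V →L[ℝ] V →L[ℝ] ℝ}
    {Xl : Submodule ℝ (TrialSpace ι)} {Yl : Submodule ℝ (TestSpace ι)} {γ : ℝ}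
    (h : (γ : EReal) ≤ discreteInfSup ι a Xl Yl) {C : ℝ}
    (hC : ∀ w v, |spaceTimeForm ι a w v| ≤ C * ‖w‖ * ‖v‖) {p y : TrialSpace ι} (hp : p ∈ Xl)
    (hp0 : p ≠ 0) (hy : ∀ v ∈ Yl, spaceTimeBilin ι a y v = 0) : γ * ‖p‖ ≤ C * ‖p + y‖ := by
  have hp0' : (⟨p, hp⟩ : Xl) ≠ 0 := fun h0 => hp0 (congrArg Subtype.val h0)
  refine mul_norm_le_of_le_iSup hp0' (le_iSup_galerkinForm h _ hp0') fun v => ?_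
  -- Adding `y` does not change the values on `Yl`, so continuity can be applied to `p + y` in place
  -- of `p`.
  calc galerkinForm a Xl Yl ⟨p, hp⟩ v = spaceTimeForm ι a (p + y) v := by
        rw [galerkinForm_apply, ← spaceTimeBilin_apply, ← spaceTimeBilin_apply, map_add,
          LinearMap.add_apply, hy v v.2, add_zero]
    _ ≤ C * ‖p + y‖ * ‖v‖ := (le_abs_self _).trans (hC _ _)

/-- Quasi-optimality of the Galerkin solution. -/
theorem norm_sub_galerkin_le {ι : V →L[ℝ] H} {a : V →L[ℝ] V →L[ℝ] ℝ}
    {Xl : Submodule ℝ (TrialSpace ι)} {Yl : Submodule ℝ (TestSpace ι)} {γ : ℝ} (hγ : 0 < γ)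
    (h : (γ : EReal) ≤ discreteInfSup ι a Xl Yl) {C : ℝ} (hγC : γ ≤ C)
    (hC : ∀ w v, |spaceTimeForm ι a w v| ≤ C * ‖w‖ * ‖v‖) {F : TestSpace ι →L[ℝ] ℝ}
    {u : TrialSpace ι} (hu : IsWeakSolution ι a F u) {ul : Xl}
    (hul : IsGalerkinSolution ι a Xl Yl F ul) :
    ‖u - (ul : TrialSpace ι)‖ ≤ C / γ * ⨅ v : Xl, ‖u - (v : TrialSpace ι)‖ := by
  have hK : 1 ≤ C / γ := (one_le_div hγ).2 hγC
  let N : Submodule ℝ (TrialSpace ι) :=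
    LinearMap.ker ((spaceTimeBilin ι a).compl₂ Yl.subtype)
  have hN : ∀ y ∈ N, ∀ v ∈ Yl, spaceTimeBilin ι a y v = 0 := fun y hy v hv =>
    LinearMap.congr_fun (LinearMap.mem_ker.1 hy) ⟨v, hv⟩
  -- Galerkin orthogonality.
  have hy : u - (ul : TrialSpace ι) ∈ N := by
    refine LinearMap.mem_ker.2 (LinearMap.ext fun v => ?_)
    simp only [LinearMap.compl₂_apply, map_sub, LinearMap.sub_apply, Submodule.subtype_apply,
      spaceTimeBilin_apply, LinearMap.zero_apply]
    rw [hu, hul v, sub_self]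
  rw [Real.mul_iInf_of_nonneg (zero_le_one.trans hK)]
  refine le_ciInf fun v => ?_
  -- Applied to `p = ul - v` and `y = u - ul`, whose sum is `u - v`.
  have := norm_le_of_complementary_bound (P := Xl) (N := N) hK (fun p hp y hy' => ?_)
    (ul - v).2 hy
  · simpa using this
  · rcases eq_or_ne p 0 with rfl | hp0
    · rw [norm_zero]
      exact mul_nonneg (zero_le_one.trans hK) (norm_nonneg _)
    · rw [div_mul_eq_mul_div, le_div_iff₀ hγ, mul_comm]
      exact mul_norm_le_of_residual_eq_zero h hC hp hp0 (hN y hy')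

end SpaceTime

/-! ### The proposition. -/

theorem mainTheorem5
    {V H : Type*}
    [NormedAddCommGroup V] [InnerProductSpace ℝ V] [CompleteSpace V]
    [TopologicalSpace.SeparableSpace V]
    [NormedAddCommGroup H] [InnerProductSpace ℝ H] [CompleteSpace H]
    [TopologicalSpace.SeparableSpace H]
    -- the dense embedding `V ⊂ H`
    (ι : V →L[ℝ] H) (hι_inj : Function.Injective ι) (hι_dense : DenseRange ι)
    -- the bounded, symmetric, coercive form of the operator `A`
    (a : V →L[ℝ] V →L[ℝ] ℝ) (ha_symm : ∀ v w, a v w = a w v)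
    (lam : ℝ) (hlam : 0 < lam) (ha_coer : ∀ v, lam * ‖v‖ ^ 2 ≤ a v v)
    -- the dense, nested families of trial and test spaces of equal, finite dimensions
    (Xl : ℕ → Submodule ℝ (TrialSpace ι)) (Yl : ℕ → Submodule ℝ (TestSpace ι))
    (hX_fin : ∀ l, FiniteDimensional ℝ (Xl l)) (hY_fin : ∀ l, FiniteDimensional ℝ (Yl l))
    (h_dim : ∀ l, Module.finrank ℝ (Xl l) = Module.finrank ℝ (Yl l))
    (hX_mono : Monotone Xl) (hY_mono : Monotone Yl)
    (hX_dense : Dense (⋃ l, (Xl l : Set (TrialSpace ι))))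
    (hY_dense : Dense (⋃ l, (Yl l : Set (TestSpace ι))))
    -- the uniform discrete inf-sup condition
    (γ : ℝ) (hγ : 0 < γ) (h_infsup : ∀ l, (γ : EReal) ≤ discreteInfSup ι a (Xl l) (Yl l)) :
    (∀ (F : TestSpace ι →L[ℝ] ℝ) (l : ℕ),
      ∃! ul : Xl l, IsGalerkinSolution ι a (Xl l) (Yl l) F ul) ∧
    (∀ (l n : ℕ) (bX : Module.Basis (Fin n) ℝ (Xl l)) (bY : Module.Basis (Fin n) ℝ (Yl l)),
      (stiffnessMatrix a bX bY).det ≠ 0) ∧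
    (∀ C : ℝ, (∀ (w : TrialSpace ι) (v : TestSpace ι),
        |spaceTimeForm ι a w v| ≤ C * ‖w‖ * ‖v‖) →
      ∀ (F : TestSpace ι →L[ℝ] ℝ) (u : TrialSpace ι), IsWeakSolution ι a F u →
        ∀ (l : ℕ) (ul : Xl l), IsGalerkinSolution ι a (Xl l) (Yl l) F ul →
          ‖u - (ul : TrialSpace ι)‖
            ≤ C / γ * ⨅ v : Xl l, ‖u - (v : TrialSpace ι)‖) := by

  refine ⟨fun F l => ?_, fun l n bX bY => ?_, fun C hC F u hu l ul hul => ?_⟩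
  · have := hX_fin l
    have := hY_fin l
    have hb := bijective_of_infSup (h_dim l) hγ (le_iSup_galerkinForm (h_infsup l))
    have hiff : ∀ w : Xl l, galerkinForm a (Xl l) (Yl l) w = F.toLinearMap ∘ₗ (Yl l).subtype ↔
        IsGalerkinSolution ι a (Xl l) (Yl l) F w := fun w => by
      rw [LinearMap.ext_iff]
      exact forall_congr' fun v => by rw [galerkinForm_apply]; rfl
    simpa only [hiff] using hb.existsUnique (F.toLinearMap ∘ₗ (Yl l).subtype)
  · have := LinearMap.det_of_ne_zero_of_injective
      (injective_of_infSup hγ (le_iSup_galerkinForm (h_infsup l))) bX bY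
    simpa only [galerkinForm_apply, stiffnessMatrix] using this
  · rcases subsingleton_or_nontrivial (TrialSpace ι) with _ | _
    -- If `X` is trivial, both sides are zero whatever the sign of `C`.
    · have h0 : ∀ w : TrialSpace ι, ‖w‖ = 0 := fun w => by
        rw [Subsingleton.elim w 0, norm_zero]
      simp [h0]
    -- It remains to see `γ ≤ C`. The given `Xl l` may be zero, so density supplies a level `m` with
    -- a nonzero `p` in `Xl m`; inf-sup there gives `γ * ‖p‖ ≤ C * ‖p‖`.
    obtain ⟨p, hp, hp0⟩ := hX_dense.inter_open_nonempty _ isOpen_compl_singleton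
      (exists_ne (0 : TrialSpace ι))
    obtain ⟨m, hm⟩ := mem_iUnion.1 hp0
    have hγC := mul_norm_le_of_residual_eq_zero (y := 0) (h_infsup m) hC hm hp (by simp)
    rw [add_zero] at hγC
    exact norm_sub_galerkin_le hγ (h_infsup l)
      (le_of_mul_le_mul_right hγC (norm_pos_iff.2 hp)) hC hu hul
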